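/- Notation. Let $J=[n]\cup[n]^*$, where $[n]=\{1,\dots,n\}$, $[n]^*=\{1^*,\dots,n^*\}$ and $i^{**}=i$. A set $X\subseteq J$ is admissible if it contains no pair $i,i^*$, and $J_n$ is the set of admissible $n$-subsets of $J$. A $B_n$-representation is a real $n\times(2n+1)$ matrix $(A,B,c)$, with $A,B\in\mathbb R^{n\times n}$ and $c\in\mathbb R^n$, such that $AB^T+BA^T+cc^T=0$. The columns of $A$ are labelled $1,\dots,n$, those of $B$ are labelled $1^*,\dots,n^*$, and $c$ is a last column with a label outside $J$. The bases of the Lagrangian matroid $\mathcal M$ that it represents are the sets $X\in J_n$ for which the $n\times n$ minor in the columns labelled by $X$ is non-zero. Pfaffians. For a skew-symmetric matrix $M=(m_{ij})$ of size $2r$, $$\operatorname{Pf}(M)=\sum_\sigma \operatorname{sign}(\sigma)\prod_{k=1}^r m_{\sigma(2k-1)\,\sigma(2k)},$$ where the sum is over the permutations $\sigma$ of $[2r]$ with $\sigma(2k-1)=\min_{j\ge 2k-1}\sigma(j)$ for $1\le k\le r$. The Pfaffian of the empty matrix is $1$, and in odd size the Pfaffian is $0$. Procedure. Start from a $B_n$-representation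 $(A,B,c)$ of $\mathcal M$, labelled as above. The following moves may be made, finitely often and in any order: 1. multiply the whole matrix on the left by an invertible $n\times n$ matrix (row operations); 2. for some $i\in[n]$, swap the columns labelled $i$ and $i^*$ together with their labels, and multiply all columns labelled $i,i^*,i+1,(i+1)^*,\dots,n,n^*$ by $-1$ (the last column is left unchanged). Suppose the matrix reached has the form $(A',I_n,c')$, with the columns of $I_n$ labelled by $D\in J_n$ and those of $A'$ labelled by $D^*$. Put $$S=A'+\tfrac12c'c'^T,\qquad M=\begin{pmatrix}S&c'\\-c'^T&0\end{pmatrix}.$$ Then $M$ is a skew-symmetric $(n+1)\times(n+1)$ matrix. For $X\in J_n$ let $\widetilde X$ be whichever of $X\cup\{n+1\}$ and $X\cup\{(n+1)^*\}$ has an even number of unstarred elements. The procedure with the choice $D$ assigns to each basis $X$ of $\mathcal M$ the sign of the Pfaffian of the principal submatrix of $M$ indexed by $(\widetilde X\mathbin{\triangle}\widetilde D)\cap[n+1]$. Theorem. Let $(A,B,c)$ be a $B_n$-representation over $\mathbb R$ of a Lagrangian matroid $\mathcal M$. For every basis $D$ of $\mathcal M$ the procedure can be carried out with the choice $D$. Every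 system of signs that it produces assigns $+1$ or $-1$ to each basis of $\mathcal M$. Any two systems of signs that it produces, with the same or with different choices of $D$, are equal on all bases or opposite on all bases. -/

import Mathlib

open Matrix

namespace LagrangianB

/-- The index set `J = [n] ∪ [n]*`: `Sum.inl i` is `i` and `Sum.inr i` is `i*`. -/
abbrev J (n : ℕ) : Type := Fin n ⊕ Fin n

/-- The involution `*` on `J`. -/
def star {n : ℕ} (a : J n) : J n := a.swap

/-- A subset of `J` is admissible if it contains no element together with its star. -/
def Admissible {n : ℕ} (K : Finset (J n)) : Prop := ∀ a ∈ K, star a ∉ K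

/-- `X ∩ [n]`: the unstarred elements of `X`. -/
def unstarred {n : ℕ} (X : Finset (J n)) : Finset (Fin n) :=
  Finset.univ.filter fun i => Sum.inl i ∈ X

/-- The admissible `n`-set whose unstarred elements are those of `T`. -/
def labelSet {n : ℕ} (T : Finset (Fin n)) : Finset (J n) :=
  Finset.univ.image fun i : Fin n => if i ∈ T then Sum.inl i else Sum.inr i

/-! ### Representations of type `B_n` and their bases -/

/-- The columns indexed by `J` of the matrix `(A, B, c)`: those of `A` are indexed by `[n]`,
those of `B` by `[n]*`. -/
def columns {n : ℕ} (A B : Matrix (Fin n) (Fin n) ℝ) : Matrix (Fin n) (J n) ℝ :=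
  Matrix.fromCols A B

/-- The row space of `(A, B, c)` is totally isotropic for the form with `⟨e_i, e_{i*}⟩ = 1`,
`⟨f, f⟩ = 1` and all other products of basis vectors zero. -/
def IsIsotropic {n : ℕ} (A B : Matrix (Fin n) (Fin n) ℝ) (c : Fin n → ℝ) : Prop :=
  A * Bᵀ + B * Aᵀ + Matrix.vecMulVec c c = 0

/-- `X` is a basis of the Lagrangian matroid represented by `(A, B, c)`: it is an admissible
`n`-subset of `J` and the `n × n` minor in the columns indexed by `X` is non-zero (its vanishing
does not depend on the enumeration `e` of `X`). The column `c` never enters a minor. -/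
def IsBasis {n : ℕ} (A B : Matrix (Fin n) (Fin n) ℝ) (X : Finset (J n)) : Prop :=
  Admissible X ∧
    ∃ e : Fin n ≃ {a : J n // a ∈ X}, ((columns A B).submatrix id fun j => (e j : J n)).det ≠ 0

/-! ### Pfaffians -/

/-- The permutations `σ` of `k` letters such that (counting from `0`) `σ (2t)` is the least of
the values `σ j`, `j ≥ 2t`, for each `t < k / 2`. -/
def IsPfaffianPerm {k : ℕ} (σ : Equiv.Perm (Fin k)) : Prop :=
  ∀ t : Fin (k / 2), ∀ j : Fin k, 2 * (t : ℕ) ≤ j → σ ⟨2 * t, by omega⟩ ≤ σ j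

instance {k : ℕ} : DecidablePred (IsPfaffianPerm (k := k)) := fun σ => by
  unfold IsPfaffianPerm; infer_instance

/-- The Pfaffian of a skew-symmetric matrix; it is `0` in odd size and `1` in size `0`. -/
def pfaffian {R : Type*} [CommRing R] {k : ℕ} (M : Matrix (Fin k) (Fin k) R) : R :=
  if Even k then
    ∑ σ ∈ Finset.univ.filter (fun σ : Equiv.Perm (Fin k) => IsPfaffianPerm σ),
      ((Equiv.Perm.sign σ : ℤ) : R) *
        ∏ t : Fin (k / 2), M (σ ⟨2 * t, by omega⟩) (σ ⟨2 * t + 1, by omega⟩)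
  else 0

/-- The principal submatrix indexed by a set of indices, in increasing order. -/
def principal {R : Type*} {m : ℕ} (M : Matrix (Fin m) (Fin m) R) (K : Finset (Fin m)) :
    Matrix (Fin K.card) (Fin K.card) R :=
  M.submatrix (K.orderEmbOfFin rfl) (K.orderEmbOfFin rfl)

/-- The sign of `X` for an orthogonal (type `D_m`) representation `(M, I_m)`, `M` skew-symmetric,
whose left columns are labelled by `F*` and whose right columns are labelled by `F`: the sign of
the Pfaffian of the principal minor of `M` indexed by `(X ∆ F) ∩ [m]`. -/
noncomputable def orthogonalSign {m : ℕ} (M : Matrix (Fin m) (Fin m) ℝ) (F X : Finset (J m)) :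
    SignType :=
  SignType.sign (pfaffian (principal M (unstarred (symmDiff X F))))

/-! ### The explosion -/

/-- Append `n+1` or `(n+1)*` to `X ⊆ [n] ∪ [n]*` so that the number of unstarred elements
becomes even. -/
def explodeSet {n : ℕ} (X : Finset (J n)) : Finset (J (n + 1)) :=
  insert (if Even (unstarred X).card then Sum.inr (Fin.last n) else Sum.inl (Fin.last n))
    (X.image (Sum.map Fin.castSucc Fin.castSucc))

/-- The left half of the exploded representation obtained from `(A, I_n, c)`, that is, the matrix
with blocks `S, c, -cᵀ, 0`, where `S = A + c cᵀ / 2`. -/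
noncomputable def explodeMatrix {n : ℕ} (A : Matrix (Fin n) (Fin n) ℝ) (c : Fin n → ℝ) :
    Matrix (Fin (n + 1)) (Fin (n + 1)) ℝ :=
  Matrix.reindex finSumFinEquiv finSumFinEquiv
    (Matrix.fromBlocks (A + (1 / 2 : ℝ) • Matrix.vecMulVec c c) (Matrix.replicateCol (Fin 1) c)
      (-Matrix.replicateRow (Fin 1) c) 0)

/-! ### The procedure -/

/-- A matrix `(left, right, last)` with labelled columns. The `i`-th column of `right` is labelled
`i` if `i ∈ T` and `i*` otherwise; the `i`-th column of `left` carries the star of that label. -/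
structure Labelled (n : ℕ) where
  left : Matrix (Fin n) (Fin n) ℝ
  right : Matrix (Fin n) (Fin n) ℝ
  last : Fin n → ℝ
  T : Finset (Fin n)

/-- Row operations: multiplication by `P` on the left (to be used with `P` invertible). -/
def Labelled.row {n : ℕ} (R : Labelled n) (P : Matrix (Fin n) (Fin n) ℝ) : Labelled n where
  left := P * R.left
  right := P * R.right
  last := P *ᵥ R.last
  T := R.T

/-- The factor by which the columns labelled `j` and `j*` are multiplied in the swap of
`i` and `i*`. -/
def swapFactor {n : ℕ} (i j : Fin n) : ℝ := if i ≤ j then -1 else 1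

/-- Swap the columns labelled `i` and `i*` together with their labels, and multiply the columns
with labels `i, i*, i+1, (i+1)*, …, n, n*` by `-1`. The last column is left alone. -/
def Labelled.swap {n : ℕ} (R : Labelled n) (i : Fin n) : Labelled n where
  left := Matrix.of fun k j => swapFactor i j * (if j = i then R.right k j else R.left k j)
  right := Matrix.of fun k j => swapFactor i j * (if j = i then R.left k j else R.right k j)
  last := R.last
  T := symmDiff R.T {i}

/-- One move of the procedure. -/
inductive Move {n : ℕ} : Labelled n → Labelled n → Prop
  | row (R : Labelled n) (P : Matrix (Fin n) (Fin n) ℝ) (hP : IsUnit P.det) : Move R (R.row P)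
  | swap (R : Labelled n) (i : Fin n) : Move R (R.swap i)

/-- The sign which a labelled representation of the form `(A, I_n, c)` with right-hand labels `D`
gives to `X`: the sign of the corresponding set in the exploded representation, whose right-hand
labels are `D` with `n+1` or `(n+1)*` appended by the same parity rule. -/
noncomputable def Labelled.signOf {n : ℕ} (R : Labelled n) (X : Finset (J n)) : SignType :=
  orthogonalSign (explodeMatrix R.left R.last) (explodeSet (labelSet R.T)) (explodeSet X)

/-- `p` is a system of signs on the bases of the matroid represented by `(A, B, c)` which the
procedure can produce with the choice `D`: finitely many moves lead from `(A, B, c)`, with its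
columns labelled by `[n]` and `[n]*`, to a matrix of the form `(A', I_n, c')` whose right-hand
columns are labelled by `D`, and `p` consists of the signs which that matrix gives. -/
def Produces {n : ℕ} (A B : Matrix (Fin n) (Fin n) ℝ) (c : Fin n → ℝ) (D : Finset (J n))
    (p : {X : Finset (J n) // IsBasis A B X} → SignType) : Prop :=
  ∃ R : Labelled n, Relation.ReflTransGen Move ⟨A, B, c, ∅⟩ R ∧ R.right = 1 ∧
    labelSet R.T = D ∧ ∀ X, p X = R.signOf X.1

end LagrangianB

/-! The signs are those of the coordinates of one pure spinor. Functions on the subsets of `[n]`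
carry an action of the Clifford algebra of the form on `ℝ^(2n+1)`: `cliff` flips one element at a
time, and the last basis vector acts by parity up to the factor `-√(1/2)`. A spinor of a matrix is a
function killed by all its rows. Row operations keep it by linearity. A swap translates its argument
by `{i}`, and the signs in the second move are exactly those that make this true (`IsSpinor.swap`).
In label coordinates the spinor is thus unchanged by every move.

For a standard form `(A', 1, c')` the spinor is determined by its value at `∅`
(`IsSpinor.proportional`) and is given, up to positive factors, by the Pfaffians of the exploded
matrix (`cliff_pfaffianSpinor`, `isSpinor_standardSpinor`). Hence any two standard forms reached
from one matrix have proportional spinors, and the sign of the ratio compares their systems of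
signs. For a basis `X`, the standard form with labels `X` has a spinor with value `1` at `X`, so no
standard form gives `X` the sign `0`. -/

namespace LagrangianB

/-! ### Clifford operators on functions of finite sets -/

/-- The sign `(-1) ^ #{k ∈ X | j < k}`. -/
def jwSign {m : ℕ} (j : Fin m) (X : Finset (Fin m)) : ℝ :=
  ∏ k, if k ∈ X ∧ j < k then -1 else 1

/-- The sign `(-1) ^ #X`. -/
def paritySign {m : ℕ} (X : Finset (Fin m)) : ℝ :=
  ∏ k, if k ∈ X then -1 else 1

lemma jwSign_symmDiff {m : ℕ} (j i : Fin m) (X : Finset (Fin m)) :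
    jwSign j (symmDiff X {i}) = (if j < i then -1 else 1) * jwSign j X := by
  have h : (if j < i then -1 else 1 : ℝ) = ∏ k, if k = i then (if j < k then -1 else 1) else 1 := by
    simp
  rw [h, jwSign, jwSign, ← Finset.prod_mul_distrib]
  refine Finset.prod_congr rfl fun k _ => ?_
  by_cases hk : k = i <;> by_cases hX : k ∈ X <;> by_cases hj : j < k <;>
    simp_all [Finset.mem_symmDiff]

lemma jwSign_mul_self {m : ℕ} (j : Fin m) (X : Finset (Fin m)) :
    jwSign j X * jwSign j X = 1 := by
  rw [jwSign, ← Finset.prod_mul_distrib]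
  exact Finset.prod_eq_one fun k _ => by split_ifs <;> norm_num

lemma jwSign_ne_zero {m : ℕ} (j : Fin m) (X : Finset (Fin m)) : jwSign j X ≠ 0 := fun h => by
  simpa [h] using jwSign_mul_self j X

lemma paritySign_symmDiff {m : ℕ} (X Y : Finset (Fin m)) :
    paritySign (symmDiff X Y) = paritySign X * paritySign Y := by
  rw [paritySign, paritySign, paritySign, ← Finset.prod_mul_distrib]
  refine Finset.prod_congr rfl fun k _ => ?_
  by_cases hk : k ∈ Y <;> by_cases hX : k ∈ X <;> simp_all [Finset.mem_symmDiff]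

lemma paritySign_eq {m : ℕ} (X : Finset (Fin m)) : paritySign X = (-1) ^ X.card := by
  simp [paritySign]

/-- The Clifford action of the vector with coordinates `v` on the creation operators and `w` on
the annihilation operators. -/
def cliff {m : ℕ} (v w : Fin m → ℝ) (φ : Finset (Fin m) → ℝ) (X : Finset (Fin m)) : ℝ :=
  ∑ j, (if j ∈ X then v j else w j) * jwSign j X * φ (symmDiff X {j})

lemma mem_symmDiff_singleton {m : ℕ} {i j : Fin m} {X : Finset (Fin m)} :
    i ∈ symmDiff X {j} ↔ (i = j ∧ i ∉ X ∨ i ≠ j ∧ i ∈ X) := by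
  simp only [Finset.mem_symmDiff, Finset.mem_singleton]
  tauto

/-- The Clifford relation. Flips of two distinct elements cancel, because exactly one of the two
orders picks up a sign from `jwSign_symmDiff`; flipping one element twice leaves the bilinear form.
-/
lemma cliff_anticomm {m : ℕ} (v w v' w' : Fin m → ℝ) (φ : Finset (Fin m) → ℝ)
    (X : Finset (Fin m)) :
    cliff v w (cliff v' w' φ) X + cliff v' w' (cliff v w φ) X =
      (∑ j, (v j * w' j + w j * v' j)) * φ X := by
  simp only [cliff, Finset.mul_sum, Finset.sum_mul]
  conv_lhs => rw [add_comm, Finset.sum_comm, ← Finset.sum_add_distrib]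
  refine Finset.sum_congr rfl fun i _ => ?_
  rw [← Finset.sum_add_distrib, Finset.sum_eq_single i]
  · have := jwSign_mul_self i X
    simp only [jwSign_symmDiff, lt_irrefl, if_false, one_mul, symmDiff_symmDiff_cancel_right,
      mem_symmDiff_singleton]
    by_cases hi : i ∈ X <;> simp only [hi] <;> simp <;> linear_combination (v i * w' i + w i * v' i) * φ X * this
  · intro j _ hj
    have e : symmDiff (symmDiff X {i}) {j} = symmDiff (symmDiff X {j}) {i} := by
      exact symmDiff_right_comm _ _ _
    have hj' : i ≠ j := hj.symm
    simp only [jwSign_symmDiff, mem_symmDiff_singleton, e]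
    rcases lt_or_gt_of_ne hj with h | h <;> by_cases hiX : i ∈ X <;>
      by_cases hjX : j ∈ X <;> simp [h, h.not_gt, hj, hj', hiX, hjX] <;> ring
  · simp

lemma cliff_congr_zero {m : ℕ} (v w : Fin m → ℝ) (φ : Finset (Fin m) → ℝ) (X : Finset (Fin m))
    (h : ∀ j, φ (symmDiff X {j}) = 0 ∨ (if j ∈ X then v j else w j) = 0) : cliff v w φ X = 0 := by
  refine Finset.sum_eq_zero fun j _ => ?_
  rcases h j with h | h <;> simp [h]

/-! ### Expansion of the Pfaffian -/

/-- The permutation of `k + 2` letters which fixes `0`, sends `1` to `p + 1` and acts as `σ`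
on the remaining letters. -/
def pfaffianPermCons {k : ℕ} (p : Fin (k + 1)) (σ : Equiv.Perm (Fin k)) :
    Equiv.Perm (Fin (k + 2)) :=
  Equiv.Perm.decomposeFin.symm
    (0, p.cycleRange.symm * Equiv.Perm.decomposeFin.symm (0, σ))

@[simp] lemma pfaffianPermCons_zero {k : ℕ} (p : Fin (k + 1)) (σ : Equiv.Perm (Fin k)) :
    pfaffianPermCons p σ 0 = 0 := by
  simp [pfaffianPermCons]

@[simp] lemma pfaffianPermCons_one {k : ℕ} (p : Fin (k + 1)) (σ : Equiv.Perm (Fin k)) :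
    pfaffianPermCons p σ 1 = p.succ := by
  rw [← Fin.succ_zero_eq_one, pfaffianPermCons]
  simp only [Equiv.Perm.decomposeFin_symm_apply_succ]
  simp [Equiv.Perm.mul_apply]

@[simp] lemma pfaffianPermCons_succ_succ {k : ℕ} (p : Fin (k + 1)) (σ : Equiv.Perm (Fin k))
    (t : Fin k) : pfaffianPermCons p σ t.succ.succ = (p.succAbove (σ t)).succ := by
  rw [pfaffianPermCons]
  simp only [Equiv.Perm.decomposeFin_symm_apply_succ]
  simp [Equiv.Perm.mul_apply]

lemma sign_pfaffianPermCons {k : ℕ} (p : Fin (k + 1)) (σ : Equiv.Perm (Fin k)) :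
    Equiv.Perm.sign (pfaffianPermCons p σ) = (-1) ^ (p : ℕ) * Equiv.Perm.sign σ := by
  simp [pfaffianPermCons, Equiv.Perm.sign_symm]

lemma pfaffianPermCons_injective {k : ℕ} {p q : Fin (k + 1)} {σ τ : Equiv.Perm (Fin k)}
    (h : pfaffianPermCons p σ = pfaffianPermCons q τ) : p = q ∧ σ = τ := by
  have hp : p = q := by
    have := congrArg (· 1) h
    simpa using this
  subst hp
  refine ⟨rfl, Equiv.ext fun t => ?_⟩
  have := congrArg (· t.succ.succ) h
  simpa using this

lemma exists_eq_pfaffianPermCons {k : ℕ} (σ : Equiv.Perm (Fin (k + 2))) (h : σ 0 = 0) :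
    ∃ p τ, σ = pfaffianPermCons p τ := by
  have key : ∀ {l : ℕ} (ρ : Equiv.Perm (Fin (l + 1))), ρ 0 = 0 →
      ∃ τ, ρ = Equiv.Perm.decomposeFin.symm (0, τ) := by
    intro l ρ hρ
    obtain ⟨⟨a, τ⟩, rfl⟩ := Equiv.Perm.decomposeFin.symm.surjective ρ
    rw [Equiv.Perm.decomposeFin_symm_apply_zero] at hρ
    exact ⟨τ, by rw [hρ]⟩
  obtain ⟨ρ, rfl⟩ := key σ h
  -- The cycle takes `ρ 0` back to `0`, so that a second letter can be split off.
  obtain ⟨τ, hτ⟩ := key ((ρ 0).cycleRange * ρ) (by simp)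
  refine ⟨ρ 0, τ, ?_⟩
  rw [pfaffianPermCons, ← hτ, ← mul_assoc]
  congr 2
  ext; simp

/-- Without the type `Fin (k / 2)` the condition is easily shifted by two letters. The bound `a + 1
< k` excludes the unpaired last letter in odd size. -/
lemma isPfaffianPerm_iff {k : ℕ} {σ : Equiv.Perm (Fin k)} :
    IsPfaffianPerm σ ↔ ∀ a b : Fin k, Even (a : ℕ) → (a : ℕ) + 1 < k → a ≤ b → σ a ≤ σ b := by
  constructor
  · rintro h a b ⟨r, hr⟩ ha hab
    have := h ⟨r, by omega⟩ b (by simp only; rw [Fin.le_def] at hab; omega)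
    have e : a = ⟨2 * r, by omega⟩ := Fin.ext (by simp; omega)
    rwa [e]
  · intro h t j hj
    exact h _ _ (by simp) (by simp only; omega) (by rw [Fin.le_def]; exact hj)

lemma isPfaffianPerm_pfaffianPermCons {k : ℕ} (p : Fin (k + 1)) (σ : Equiv.Perm (Fin k)) :
    IsPfaffianPerm (pfaffianPermCons p σ) ↔ IsPfaffianPerm σ := by
  rw [isPfaffianPerm_iff, isPfaffianPerm_iff]
  constructor
  · intro h a b ha hk hab
    have := h a.succ.succ b.succ.succ (by simpa [Nat.even_add_one] using ha)
      (by simp; omega) (by simpa using hab)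
    simpa using this
  · intro h a b ha hk hab
    obtain rfl | ⟨a, rfl⟩ := a.eq_zero_or_eq_succ
    · simp
    obtain rfl | ⟨a, rfl⟩ := a.eq_zero_or_eq_succ
    · simp at ha
    obtain rfl | ⟨b, rfl⟩ := b.eq_zero_or_eq_succ
    · simp at hab
    obtain rfl | ⟨b, rfl⟩ := b.eq_zero_or_eq_succ
    · exact absurd (Fin.succ_le_succ_iff.1 hab) (by simp)
    have := h a b (by simpa [Nat.even_add_one] using ha) (by simp at hk; omega) (by simpa using hab)
    simpa using this

/-- Expansion of the Pfaffian along the first row. -/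
lemma pfaffian_succ_succ {R : Type*} [CommRing R] {k : ℕ} (hk : Even k)
    (M : Matrix (Fin (k + 2)) (Fin (k + 2)) R) :
    pfaffian M = ∑ p : Fin (k + 1), (-1) ^ (p : ℕ) * M 0 p.succ *
      pfaffian (M.submatrix (fun t => (p.succAbove t).succ) fun t => (p.succAbove t).succ) := by
  have hk2 : Even (k + 2) := by simpa [Nat.even_add_one] using hk
  simp only [pfaffian, hk, hk2, if_true, Finset.mul_sum]
  rw [← Finset.sum_product']
  symm
  refine Finset.sum_bij (fun x _ => pfaffianPermCons x.1 x.2) ?_ ?_ ?_ ?_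
  · rintro ⟨p, σ⟩ h
    simpa [isPfaffianPerm_pfaffianPermCons] using h
  · rintro ⟨p, σ⟩ - ⟨q, τ⟩ - h
    exact Prod.ext_iff.2 (pfaffianPermCons_injective h)
  · intro σ hσ
    have hσ := (Finset.mem_filter.1 hσ).2
    have h0 : σ 0 = 0 := by
      have := isPfaffianPerm_iff.1 hσ 0 (σ.symm 0) (by simp) (by simp) (Fin.zero_le _)
      simpa using this
    obtain ⟨p, τ, rfl⟩ := exists_eq_pfaffianPermCons σ h0
    exact ⟨(p, τ), by simpa [isPfaffianPerm_pfaffianPermCons] using hσ, rfl⟩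
  · rintro ⟨p, σ⟩ -
    have h2 : (k + 2) / 2 = k / 2 + 1 := by omega
    rw [← (finCongr h2).symm.prod_comp, Fin.prod_univ_succ, sign_pfaffianPermCons]
    have e0 : ∀ h : 2 * (((finCongr h2).symm 0 : Fin _) : ℕ) < k + 2,
      (⟨2 * (((finCongr h2).symm 0 : Fin _) : ℕ), h⟩ : Fin (k + 2)) = 0 := fun h => Fin.ext (by simp)
    have e1 : ∀ h : 2 * (((finCongr h2).symm 0 : Fin _) : ℕ) + 1 < k + 2,
      (⟨2 * (((finCongr h2).symm 0 : Fin _) : ℕ) + 1, h⟩ : Fin (k + 2)) = 1 := fun h => Fin.ext (by simp)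
    have e2 : ∀ (t : Fin (k / 2)) (h : 2 * (((finCongr h2).symm t.succ : Fin _) : ℕ) < k + 2),
      (⟨2 * (((finCongr h2).symm t.succ : Fin _) : ℕ), h⟩ : Fin (k + 2)) =
        (⟨2 * t, by omega⟩ : Fin k).succ.succ := fun t h => Fin.ext (by simp; omega)
    have e3 : ∀ (t : Fin (k / 2)) (h : 2 * (((finCongr h2).symm t.succ : Fin _) : ℕ) + 1 < k + 2),
      (⟨2 * (((finCongr h2).symm t.succ : Fin _) : ℕ) + 1, h⟩ : Fin (k + 2)) =
        (⟨2 * t + 1, by omega⟩ : Fin k).succ.succ := fun t h => Fin.ext (by simp; omega)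
    simp only [e0, e1, e2, e3, pfaffianPermCons_zero, pfaffianPermCons_one,
      pfaffianPermCons_succ_succ, Matrix.submatrix_apply]
    push_cast
    ring

/-! ### Pfaffians of principal submatrices as a pure spinor -/

lemma symmDiff_singleton_of_mem {m : ℕ} {j : Fin m} {X : Finset (Fin m)} (h : j ∈ X) :
    symmDiff X {j} = X.erase j := by
  ext k
  by_cases hk : k = j <;> simp_all [mem_symmDiff_singleton]

lemma symmDiff_singleton_of_notMem {m : ℕ} {j : Fin m} {X : Finset (Fin m)} (h : j ∉ X) :
    symmDiff X {j} = insert j X := by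
  ext k
  by_cases hk : k = j <;> simp_all [mem_symmDiff_singleton]

lemma pfaffian_principal_eq {R : Type*} [CommRing R] {k m : ℕ} (M : Matrix (Fin m) (Fin m) R)
    {K : Finset (Fin m)} {f : Fin k → Fin m} (hf : StrictMono f) (hK : Finset.univ.image f = K) :
    pfaffian (principal M K) = pfaffian (M.submatrix f f) := by
  obtain rfl : k = K.card := by
    rw [← hK, Finset.card_image_of_injective _ hf.injective, Finset.card_univ, Fintype.card_fin]
  have : f = K.orderEmbOfFin rfl :=
    Finset.orderEmbOfFin_unique rfl (fun x => hK ▸ Finset.mem_image_of_mem f (Finset.mem_univ x)) hf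
  rw [principal, ← this]

lemma jwSign_eq {m : ℕ} (j : Fin m) (X : Finset (Fin m)) :
    jwSign j X = (-1) ^ (X.filter (j < ·)).card := by
  rw [jwSign, Finset.prod_ite, Finset.prod_const, Finset.prod_const_one, mul_one,
    ← Finset.filter_filter, Finset.filter_univ_mem]

/-- There are `k - p` elements above the one in position `p`, and `k` is even. So `jwSign`, which
counts from above, agrees with the signs of the expansion along the first row. -/
lemma jwSign_orderEmbOfFin {m k : ℕ} (hk : Even k) {Y : Finset (Fin m)} (h : Y.card = k + 1)
    (p : Fin (k + 1)) : jwSign (Y.orderEmbOfFin h p) Y = (-1) ^ (p : ℕ) := by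
  have : Y.filter (Y.orderEmbOfFin h p < ·) = (Finset.Ioi p).map (Y.orderEmbOfFin h).toEmbedding := by
    ext x
    simp only [Finset.mem_filter, Finset.mem_map, Finset.mem_Ioi]
    constructor
    · rintro ⟨hx, hlt⟩
      have : x ∈ Set.range (Y.orderEmbOfFin h) := by simpa using hx
      obtain ⟨q, rfl⟩ := this
      exact ⟨q, by simpa using hlt, rfl⟩
    · rintro ⟨q, hq, rfl⟩
      exact ⟨Finset.orderEmbOfFin_mem _ _ _, by simpa using hq⟩
  rw [jwSign_eq, this, Finset.card_map, Fin.card_Ioi]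
  apply neg_one_pow_congr
  have := p.2
  obtain ⟨r, rfl⟩ := hk
  simp only [Nat.even_iff]
  omega

/-- The Pfaffians of the principal submatrices. -/
def pfaffianSpinor {m : ℕ} (M : Matrix (Fin m) (Fin m) ℝ) (X : Finset (Fin m)) : ℝ :=
  pfaffian (principal M X)

lemma pfaffianSpinor_odd {m : ℕ} (M : Matrix (Fin m) (Fin m) ℝ) {X : Finset (Fin m)}
    (h : ¬ Even X.card) : pfaffianSpinor M X = 0 := by
  simp [pfaffianSpinor, pfaffian, h]

lemma pfaffianSpinor_empty {m : ℕ} (M : Matrix (Fin m) (Fin m) ℝ) : pfaffianSpinor M ∅ = 1 := by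
  rw [pfaffianSpinor, pfaffian_principal_eq M (f := (Fin.elim0 : Fin 0 → Fin m))
    (fun a => a.elim0) (K := ∅) (by simp)]
  simp [pfaffian, IsPfaffianPerm, Finset.filter_true_of_mem]

lemma pfaffianSpinor_insert {m : ℕ} (M : Matrix (Fin m) (Fin m) ℝ) {i : Fin m}
    {Y : Finset (Fin m)} (hY : ¬ Even Y.card) (hi : ∀ j ∈ Y, i < j) :
    pfaffianSpinor M (insert i Y) =
      ∑ j ∈ Y, M i j * jwSign j Y * pfaffianSpinor M (Y.erase j) := by
  obtain ⟨k, hk, h⟩ : ∃ k, Even k ∧ Y.card = k + 1 := by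
    obtain ⟨r, hr⟩ := Nat.not_even_iff_odd.1 hY
    exact ⟨2 * r, by simp, hr⟩
  set g := Y.orderEmbOfFin h with hg
  have hgY : Finset.univ.map g.toEmbedding = Y := by
    rw [Finset.map_eq_image]
    exact Finset.image_orderEmbOfFin_univ Y h
  have hgi : Finset.univ.image g = Y := Finset.image_orderEmbOfFin_univ Y h
  have hcons : StrictMono (Fin.cons i g : Fin (k + 2) → Fin m) := by
    intro x y hxy
    obtain rfl | ⟨y, rfl⟩ := y.eq_zero_or_eq_succ
    · simp at hxy
    obtain rfl | ⟨x, rfl⟩ := x.eq_zero_or_eq_succ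
    · simpa using hi _ (Finset.orderEmbOfFin_mem _ _ _)
    · simpa using hxy
  have herase : ∀ p, pfaffianSpinor M (Y.erase (g p)) =
      pfaffian (M.submatrix (g ∘ p.succAbove) (g ∘ p.succAbove)) := by
    intro p
    refine pfaffian_principal_eq M (g.strictMono.comp (Fin.strictMono_succAbove p)) ?_
    rw [← hgi, ← Finset.image_image, Fin.image_succAbove_univ, ← Finset.image_erase g.injective]
    congr 1
    ext; simp
  rw [pfaffianSpinor, pfaffian_principal_eq M hcons, pfaffian_succ_succ hk]
  · conv_rhs => rw [← hgY]
    rw [Finset.sum_map]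
    refine Finset.sum_congr rfl fun p _ => ?_
    have e1 : jwSign (g p) Y = (-1) ^ (p : ℕ) := jwSign_orderEmbOfFin hk h p
    simp only [hgY, RelEmbedding.coe_toEmbedding, e1, herase]
    simp only [Matrix.submatrix_apply, Matrix.submatrix_submatrix, Fin.cons_zero, Fin.cons_succ]
    rw [mul_comm (M i (g p))]
    rfl
  · rw [← hgi]
    ext x
    simp [Fin.exists_fin_succ, eq_comm]

lemma cliff_single {m : ℕ} (v : Fin m → ℝ) (i : Fin m) (φ : Finset (Fin m) → ℝ)
    (X : Finset (Fin m)) : cliff v (Pi.single i 1) φ X =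
      ∑ j ∈ X, v j * jwSign j X * φ (X.erase j) +
        if i ∈ X then 0 else jwSign i X * φ (insert i X) := by
  rw [cliff, ← Finset.sum_add_sum_compl X]
  congr 1
  · exact Finset.sum_congr rfl fun j hj => by rw [if_pos hj, symmDiff_singleton_of_mem hj]
  · split_ifs with hi
    · refine Finset.sum_eq_zero fun j hj => ?_
      have hj := Finset.mem_compl.1 hj
      have : j ≠ i := by rintro rfl; exact hj hi
      simp [hj, this]
    · rw [Finset.sum_eq_single i]
      · simp [hi, symmDiff_singleton_of_notMem]
      · intro j hj hji
        simp [Finset.mem_compl.1 hj, hji]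
      · simp [hi]

/-- For even `Y` only sets of odd size occur. For odd `Y` this is the expansion along row `i`, with
`jwSign i Y = -1` since all of `Y` lies above `i`. -/
lemma cliff_pfaffianSpinor_of_lt {m : ℕ} (M : Matrix (Fin m) (Fin m) ℝ) {i : Fin m}
    {Y : Finset (Fin m)} (hi : ∀ j ∈ Y, i < j) :
    cliff (M i) (Pi.single i 1) (pfaffianSpinor M) Y = 0 := by
  have hiY : i ∉ Y := fun h => lt_irrefl _ (hi i h)
  rw [cliff_single, if_neg hiY]
  by_cases hY : Even Y.card
  · rw [pfaffianSpinor_odd M (X := insert i Y), mul_zero, add_zero]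
    · refine Finset.sum_eq_zero fun j hj => ?_
      rw [pfaffianSpinor_odd, mul_zero]
      have := Finset.card_erase_add_one hj
      rw [← this, Nat.even_add_one] at hY
      exact hY
    · rw [Finset.card_insert_of_notMem hiY, Nat.even_add_one]
      exact not_not.2 hY
  · rw [pfaffianSpinor_insert M hY hi, jwSign_eq i, Finset.filter_true_of_mem hi,
      (Nat.not_even_iff_odd.1 hY).neg_one_pow]
    ring

/-- The Pfaffians of the principal submatrices of a skew-symmetric matrix `M` form the pure
spinor of the row space of `(M, 1)`. -/
lemma cliff_pfaffianSpinor {m : ℕ} {M : Matrix (Fin m) (Fin m) ℝ} (hM : ∀ i j, M i j + M j i = 0)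
    (i : Fin m) (Y : Finset (Fin m)) :
    cliff (M i) (Pi.single i 1) (pfaffianSpinor M) Y = 0 := by
  induction hc : Y.card using Nat.strong_induction_on generalizing Y i with
  | _ c ih =>
  by_cases hi : ∀ j ∈ Y, i < j
  · exact cliff_pfaffianSpinor_of_lt M hi
  push Not at hi
  obtain ⟨b, hbY, hbi⟩ := hi
  obtain ⟨a, haY, hmin⟩ := Y.exists_minimal ⟨b, hbY⟩
  have hmin : ∀ j ∈ Y, a ≤ j := fun j hj => (le_total a j).elim id (hmin hj)
  have hai : a ≤ i := (hmin b hbY).trans hbi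
  have haZ : ∀ j ∈ Y.erase a, a < j := fun j hj =>
    lt_of_le_of_ne (hmin j (Finset.mem_of_mem_erase hj)) (Finset.ne_of_mem_erase hj).symm
  have hcard := Finset.card_erase_add_one haY
  -- Apart from inserting `a`, row `a` only removes elements here, which leads to sets covered by
  -- the induction hypothesis.
  have h1 : cliff (M a) (Pi.single a 1) (cliff (M i) (Pi.single i 1) (pfaffianSpinor M))
      (Y.erase a) = jwSign a (Y.erase a) *
        cliff (M i) (Pi.single i 1) (pfaffianSpinor M) Y := by
    rw [cliff_single, if_neg (Finset.notMem_erase a Y), Finset.insert_erase haY,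
      Finset.sum_eq_zero, zero_add]
    intro j hj
    rw [ih ((Y.erase a).erase j).card _ i _ rfl, mul_zero]
    have := Finset.card_erase_add_one hj
    omega
  have h2 := cliff_anticomm (M a) (Pi.single a 1) (M i) (Pi.single i 1) (pfaffianSpinor M)
    (Y.erase a)
  -- Skew symmetry of `M` says that the rows of `(M, 1)` are mutually orthogonal, so their operators
  -- anticommute.
  have h3 : ∑ j, (M a j * (Pi.single i 1 : Fin m → ℝ) j + (Pi.single a 1 : Fin m → ℝ) j * M i j)
      = 0 := by
    simp [Finset.sum_add_distrib, Pi.single_apply, hM]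
  rw [h3, zero_mul, h1] at h2
  -- For `i = a` the two products coincide. For `a < i` the second one vanishes, since `a` lies
  -- below every set that it reaches with non-zero coefficient.
  rcases hai.eq_or_lt with rfl | hlt
  · rw [h1] at h2
    exact (mul_eq_zero.1 (by linarith)).resolve_left (jwSign_ne_zero a (Y.erase a))
  · rw [cliff_congr_zero (M i) (Pi.single i 1) (cliff (M a) _ _), add_zero] at h2
    · exact (mul_eq_zero.1 h2).resolve_left (jwSign_ne_zero a (Y.erase a))
    · intro j
      by_cases hj : j = i ∨ j ∈ Y.erase a
      · left
        apply cliff_pfaffianSpinor_of_lt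
        intro k hk
        rw [mem_symmDiff_singleton] at hk
        rcases hk with ⟨rfl, hk⟩ | ⟨-, hk⟩
        · exact hj.elim (fun h => h ▸ hlt) fun h => absurd h hk
        · exact haZ k hk
      · push Not at hj
        right
        rw [if_neg hj.2, Pi.single_eq_of_ne hj.1]

lemma even_card_symmDiff {m : ℕ} (X Y : Finset (Fin m)) :
    Even (symmDiff X Y).card ↔ (Even X.card ↔ Even Y.card) := by
  have h := paritySign_symmDiff X Y
  simp only [paritySign_eq] at h
  by_cases h1 : Even (symmDiff X Y).card <;> by_cases h2 : Even X.card <;>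
    by_cases h3 : Even Y.card <;>
    simp [h1, h2, h3, Odd.neg_one_pow, Nat.not_even_iff_odd.1] at h ⊢ <;>
    norm_num at h

/-! ### Spinors of labelled matrices -/

/-- `φ` is annihilated by the rows of `R`, where the last column acts as a multiple of the
parity. -/
def IsSpinor {n : ℕ} (R : Labelled n) (φ : Finset (Fin n) → ℝ) : Prop :=
  ∀ k X, cliff (R.left k) (R.right k) φ X = √(1 / 2) * R.last k * paritySign X * φ X

/-- `φ` is a spinor of `R` in the coordinates given by the labels. -/
def IsLabelledSpinor {n : ℕ} (R : Labelled n) (φ : Finset (Fin n) → ℝ) : Prop :=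
  IsSpinor R fun X => φ (symmDiff X R.T)

lemma cliff_sum {m : ℕ} {ι : Type*} [Fintype ι] (a : ι → ℝ) (v w : ι → Fin m → ℝ)
    (φ : Finset (Fin m) → ℝ) (X : Finset (Fin m)) :
    cliff (fun j => ∑ l, a l * v l j) (fun j => ∑ l, a l * w l j) φ X =
      ∑ l, a l * cliff (v l) (w l) φ X := by
  simp only [cliff, Finset.mul_sum]
  rw [Finset.sum_comm]
  refine Finset.sum_congr rfl fun j _ => ?_
  split_ifs <;> simp only [Finset.sum_mul] <;> exact Finset.sum_congr rfl fun l _ => by ring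

lemma IsSpinor.row {n : ℕ} {R : Labelled n} {φ : Finset (Fin n) → ℝ} (h : IsSpinor R φ)
    (P : Matrix (Fin n) (Fin n) ℝ) : IsSpinor (R.row P) φ := by
  intro k X
  have := cliff_sum (P k) R.left R.right φ X
  simp only [h _ X] at this
  refine this.trans ?_
  simp only [Labelled.row, Matrix.mulVec, dotProduct, Finset.mul_sum, Finset.sum_mul]
  exact Finset.sum_congr rfl fun l _ => by ring

/-- Translation by `{i}` changes `jwSign j` for `j < i`, and `swapFactor` supplies the sign for `j ≥
i`. So every term changes sign, as does the parity on the other side; this is why the last column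
stays unchanged. -/
lemma IsSpinor.swap {n : ℕ} {R : Labelled n} {φ : Finset (Fin n) → ℝ} (h : IsSpinor R φ)
    (i : Fin n) : IsSpinor (R.swap i) fun X => φ (symmDiff X {i}) := by
  intro k X
  have hp : paritySign X = -paritySign (symmDiff X {i}) := by
    rw [paritySign_symmDiff, paritySign_eq {i}]
    simp
  have hk := h k (symmDiff X {i})
  have hc : cliff ((R.swap i).left k) ((R.swap i).right k) (fun X => φ (symmDiff X {i})) X =
      -cliff (R.left k) (R.right k) φ (symmDiff X {i}) := by
    rw [cliff, cliff, ← Finset.sum_neg_distrib]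
    refine Finset.sum_congr rfl fun j _ => ?_
    rw [symmDiff_right_comm X {i} {j}, jwSign_symmDiff]
    simp only [Labelled.swap, Matrix.of_apply, mem_symmDiff_singleton, swapFactor]
    by_cases hj : j = i
    · subst hj
      by_cases hX : j ∈ X <;> simp [hX]
    · rcases lt_or_gt_of_ne hj with hlt | hlt <;> by_cases hX : j ∈ X <;>
        simp [hX, hj, hlt, hlt.le, hlt.not_ge, hlt.not_gt]
  rw [hc, hk, hp]
  simp only [Labelled.swap]
  ring

lemma IsLabelledSpinor.move {n : ℕ} {R R' : Labelled n} {φ : Finset (Fin n) → ℝ}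
    (h : IsLabelledSpinor R φ) (hm : Move R R') : IsLabelledSpinor R' φ := by
  cases hm with
  | row P _ => exact h.row P
  | swap i =>
    have := h.swap i
    simpa only [IsLabelledSpinor, Labelled.swap, symmDiff_assoc, symmDiff_comm R.T {i}] using this

/-! ### Reversibility of the moves and invariance of isotropy -/

lemma Labelled.swap_swap {n : ℕ} (R : Labelled n) (i : Fin n) : (R.swap i).swap i = R := by
  have hs : ∀ j, swapFactor i j * swapFactor i j = 1 := fun j => by
    unfold swapFactor; split_ifs <;> norm_num
  obtain ⟨L, Q, c, T⟩ := R
  simp only [Labelled.swap, Labelled.mk.injEq, symmDiff_symmDiff_cancel_right, and_true]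
  constructor <;> ext k j <;> by_cases hj : j = i <;> simp [hj, ← mul_assoc, hs]

lemma Labelled.row_row_inv {n : ℕ} (R : Labelled n) {P : Matrix (Fin n) (Fin n) ℝ}
    (hP : IsUnit P.det) : (R.row P).row P⁻¹ = R := by
  obtain ⟨L, Q, c, T⟩ := R
  simp [Labelled.row, Matrix.nonsing_inv_mul_cancel_left _ _ hP, Matrix.nonsing_inv_mul _ hP]

lemma Move.symm {n : ℕ} {R R' : Labelled n} (h : Move R R') : Move R' R := by
  cases h with
  | row P hP =>
    have := Move.row (R.row P) P⁻¹ (Matrix.isUnit_nonsing_inv_det _ hP)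
    rwa [R.row_row_inv hP] at this
  | swap i =>
    have := Move.swap (R.swap i) i
    rwa [R.swap_swap i] at this

lemma IsLabelledSpinor.reach {n : ℕ} {R R' : Labelled n} {φ : Finset (Fin n) → ℝ}
    (h : IsLabelledSpinor R φ) (hm : Relation.ReflTransGen Move R R') : IsLabelledSpinor R' φ := by
  induction hm with
  | refl => exact h
  | tail _ hm ih => exact ih.move hm

lemma isIsotropic_iff {n : ℕ} {A B : Matrix (Fin n) (Fin n) ℝ} {c : Fin n → ℝ} :
    IsIsotropic A B c ↔ ∀ k l, ∑ j, (A k j * B l j + B k j * A l j) + c k * c l = 0 := by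
  rw [IsIsotropic, ← Matrix.ext_iff]
  simp [Matrix.mul_apply, Matrix.vecMulVec_apply, Finset.sum_add_distrib]

lemma IsIsotropic.move {n : ℕ} {R R' : Labelled n} (h : IsIsotropic R.left R.right R.last)
    (hm : Move R R') : IsIsotropic R'.left R'.right R'.last := by
  cases hm with
  | row P _ =>
    have e : (R.row P).left * (R.row P).rightᵀ + (R.row P).right * (R.row P).leftᵀ +
        Matrix.vecMulVec (R.row P).last (R.row P).last =
        P * (R.left * R.rightᵀ + R.right * R.leftᵀ + Matrix.vecMulVec R.last R.last) * Pᵀ := by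
      simp only [Labelled.row, Matrix.transpose_mul, Matrix.mul_add, Matrix.add_mul,
        Matrix.mul_assoc, Matrix.vecMulVec_mul, Matrix.mul_vecMulVec, Matrix.vecMul_transpose]
    rw [IsIsotropic] at h
    rw [IsIsotropic, e, h, Matrix.mul_zero, Matrix.zero_mul]
  | swap i =>
    rw [isIsotropic_iff] at h ⊢
    intro k l
    rw [← h k l]
    simp only [Labelled.swap, Matrix.of_apply]
    congr 1
    refine Finset.sum_congr rfl fun j _ => ?_
    have hs : swapFactor i j * swapFactor i j = 1 := by
      unfold swapFactor; split_ifs <;> norm_num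
    split_ifs
    · linear_combination (R.left k j * R.right l j + R.right k j * R.left l j) * hs
    · linear_combination (R.left k j * R.right l j + R.right k j * R.left l j) * hs

lemma IsIsotropic.reach {n : ℕ} {R R' : Labelled n} (h : IsIsotropic R.left R.right R.last)
    (hm : Relation.ReflTransGen Move R R') : IsIsotropic R'.left R'.right R'.last := by
  induction hm with
  | refl => exact h
  | tail _ hm ih => exact ih.move hm

/-! ### Uniqueness of the spinor -/

lemma IsSpinor.eq_zero {n : ℕ} {R : Labelled n} (hR : R.right = 1) {φ : Finset (Fin n) → ℝ}
    (h : IsSpinor R φ) (h0 : φ ∅ = 0) (X : Finset (Fin n)) : φ X = 0 := by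
  induction hc : X.card using Nat.strong_induction_on generalizing X with
  | _ c ih =>
  obtain rfl | ⟨i, hi⟩ := X.eq_empty_or_nonempty
  · exact h0
  have hcard := Finset.card_erase_add_one hi
  -- Row `i` of the identity block reaches `X` by inserting `i`; every other set in this equation is
  -- smaller than `X`.
  have h1 := h i (X.erase i)
  have e : R.right i = Pi.single i 1 := by
    ext j; rw [hR, Matrix.one_apply, Pi.single_apply]; simp [eq_comm]
  rw [e, cliff_single, if_neg (Finset.notMem_erase i X), Finset.insert_erase hi,
    Finset.sum_eq_zero, ih (X.erase i).card (by omega) _ rfl] at h1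
  · simpa [jwSign_ne_zero] using h1
  · intro j hj
    have := Finset.card_erase_add_one hj
    rw [ih ((X.erase i).erase j).card (by omega) _ rfl, mul_zero]

lemma IsSpinor.proportional {n : ℕ} {R : Labelled n} (hR : R.right = 1)
    {φ ψ : Finset (Fin n) → ℝ} (hφ : IsSpinor R φ) (hψ : IsSpinor R ψ) (h1 : φ ∅ = 1)
    (X : Finset (Fin n)) : ψ X = ψ ∅ * φ X := by
  have h : IsSpinor R fun X => ψ X - ψ ∅ * φ X := by
    intro k X
    have e : cliff (R.left k) (R.right k) (fun X => ψ X - ψ ∅ * φ X) X =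
        cliff (R.left k) (R.right k) ψ X - ψ ∅ * cliff (R.left k) (R.right k) φ X := by
      simp only [cliff, Finset.mul_sum, ← Finset.sum_sub_distrib]
      exact Finset.sum_congr rfl fun j _ => by ring
    rw [e, hφ, hψ]
    ring
  have := h.eq_zero hR (by simp [h1]) X
  linarith

/-! ### The spinor of a matrix in standard form -/

/-- The set `X ⊆ [n]` as a subset of `[n + 1]`, with `n + 1` added if `b` holds. -/
def liftSet {n : ℕ} (b : Bool) (X : Finset (Fin n)) : Finset (Fin (n + 1)) :=
  (if b then {Fin.last n} else ∅) ∪ X.map Fin.castSuccEmb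

@[simp] lemma castSucc_mem_liftSet {n : ℕ} {b : Bool} {X : Finset (Fin n)} {j : Fin n} :
    j.castSucc ∈ liftSet b X ↔ j ∈ X := by
  cases b <;> simp [liftSet, Fin.castSucc_ne_last]

@[simp] lemma last_mem_liftSet {n : ℕ} {b : Bool} {X : Finset (Fin n)} :
    Fin.last n ∈ liftSet b X ↔ b = true := by
  cases b <;> simp [liftSet, Fin.castSucc_ne_last]

lemma eq_liftSet_iff {n : ℕ} {b : Bool} {X : Finset (Fin n)} {Y : Finset (Fin (n + 1))} :
    Y = liftSet b X ↔ (Fin.last n ∈ Y ↔ b = true) ∧ ∀ j : Fin n, j.castSucc ∈ Y ↔ j ∈ X := by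
  constructor
  · rintro rfl
    simp
  · rintro ⟨h1, h2⟩
    ext k
    refine Fin.lastCases ?_ (fun j => ?_) k
    · rw [h1, last_mem_liftSet]
    · rw [h2, castSucc_mem_liftSet]

lemma liftSet_symmDiff_castSucc {n : ℕ} (b : Bool) (X : Finset (Fin n)) (j : Fin n) :
    symmDiff (liftSet b X) {j.castSucc} = liftSet b (symmDiff X {j}) := by
  rw [eq_liftSet_iff]
  simp [mem_symmDiff_singleton, (Fin.castSucc_ne_last j).symm]

lemma liftSet_symmDiff_last {n : ℕ} (b : Bool) (X : Finset (Fin n)) :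
    symmDiff (liftSet b X) {Fin.last n} = liftSet (!b) X := by
  rw [eq_liftSet_iff]
  simp [mem_symmDiff_singleton, Fin.castSucc_ne_last]

lemma jwSign_castSucc_liftSet {n : ℕ} (b : Bool) (X : Finset (Fin n)) (j : Fin n) :
    jwSign j.castSucc (liftSet b X) = (if b then -1 else 1) * jwSign j X := by
  rw [jwSign, Fin.prod_univ_castSucc, jwSign, mul_comm]
  simp [Fin.castSucc_lt_last]

lemma jwSign_last {n : ℕ} (X : Finset (Fin (n + 1))) : jwSign (Fin.last n) X = 1 :=
  Finset.prod_eq_one fun k _ => if_neg fun h => (Fin.le_last k).not_gt h.2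

/-- The subset of `[n + 1]` of even size which restricts to `X`. -/
def evenLift {n : ℕ} (X : Finset (Fin n)) : Finset (Fin (n + 1)) :=
  liftSet (!decide (Even X.card)) X

lemma cliff_liftSet {n : ℕ} (v w : Fin (n + 1) → ℝ) (φ : Finset (Fin (n + 1)) → ℝ) (b : Bool)
    (X : Finset (Fin n)) :
    cliff v w φ (liftSet b X) =
      (if b then -1 else 1) * cliff (v ∘ Fin.castSucc) (w ∘ Fin.castSucc) (fun Y => φ (liftSet b Y)) X
        + (if b then v (Fin.last n) else w (Fin.last n)) * φ (liftSet (!b) X) := by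
  rw [cliff, Fin.sum_univ_castSucc, cliff, Finset.mul_sum]
  congr 1
  · refine Finset.sum_congr rfl fun j _ => ?_
    rw [liftSet_symmDiff_castSucc, jwSign_castSucc_liftSet]
    simp only [castSucc_mem_liftSet, Function.comp]
    ring
  · rw [liftSet_symmDiff_last, jwSign_last]
    simp

/-- The spinor of `(A, 1, c)`. -/
noncomputable def standardSpinor {n : ℕ} (A : Matrix (Fin n) (Fin n) ℝ) (c : Fin n → ℝ)
    (X : Finset (Fin n)) : ℝ :=
  (if Even X.card then 1 else √(1 / 2)) * pfaffianSpinor (explodeMatrix A c) (evenLift X)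

lemma standardSpinor_empty {n : ℕ} (A : Matrix (Fin n) (Fin n) ℝ) (c : Fin n → ℝ) :
    standardSpinor A c ∅ = 1 := by
  have : evenLift (∅ : Finset (Fin n)) = ∅ := by simp [evenLift, liftSet]
  simp [standardSpinor, this, pfaffianSpinor_empty]

section explodeMatrix
variable {n : ℕ} (A : Matrix (Fin n) (Fin n) ℝ) (c : Fin n → ℝ) (i j : Fin n)

@[simp] lemma explodeMatrix_castSucc_castSucc :
    explodeMatrix A c i.castSucc j.castSucc = A i j + 1 / 2 * (c i * c j) := by
  simp [explodeMatrix, Matrix.vecMulVec_apply]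

@[simp] lemma explodeMatrix_castSucc_last :
    explodeMatrix A c i.castSucc (Fin.last n) = c i := by
  simp [explodeMatrix]

@[simp] lemma explodeMatrix_last_castSucc :
    explodeMatrix A c (Fin.last n) i.castSucc = -c i := by
  simp [explodeMatrix]

@[simp] lemma explodeMatrix_last_last :
    explodeMatrix A c (Fin.last n) (Fin.last n) = 0 := by
  simp [explodeMatrix]

end explodeMatrix

lemma explodeMatrix_skew {n : ℕ} {A : Matrix (Fin n) (Fin n) ℝ} {c : Fin n → ℝ}
    (h : IsIsotropic A 1 c) (i j : Fin (n + 1)) :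
    explodeMatrix A c i j + explodeMatrix A c j i = 0 := by
  have h : ∀ i j, A i j + A j i + c i * c j = 0 := by
    intro i j
    have := isIsotropic_iff.1 h i j
    simpa [Matrix.one_apply, Finset.sum_add_distrib] using this
  refine Fin.lastCases ?_ (fun i => ?_) i <;> refine Fin.lastCases ?_ (fun j => ?_) j
  · simp
  · simp
  · simp
  · simp only [explodeMatrix_castSucc_castSucc]
    linear_combination h i j

lemma isSpinor_standardSpinor {n : ℕ} {R : Labelled n} (hR : R.right = 1)
    (h : IsIsotropic R.left R.right R.last) : IsSpinor R (standardSpinor R.left R.last) := by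
  intro i X
  obtain ⟨A, Q, c, T⟩ := R
  simp only at hR h ⊢
  subst hR
  set M := explodeMatrix A c with hM
  -- This makes `liftSet b X` a set of odd size, so that its one-element flips are the even sets,
  -- where Pfaffians can be non-zero.
  set b := decide (Even X.card) with hb
  have hκ : √(1 / 2 : ℝ) * √(1 / 2) = 1 / 2 := Real.mul_self_sqrt (by norm_num)
  have hz : ∀ k, cliff (M k) (Pi.single k 1) (pfaffianSpinor M) (liftSet b X) = 0 := fun k =>
    cliff_pfaffianSpinor (explodeMatrix_skew h) k _
  -- Adding `c i / 2` times the last row of the exploded matrix to row `i` cancels the term `c cᵀ /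
  -- 2`.
  have hrow : cliff (A i) ((1 : Matrix (Fin n) (Fin n) ℝ) i)
        (fun Y => pfaffianSpinor M (liftSet b Y)) X =
      cliff (M i.castSucc ∘ Fin.castSucc) (Pi.single i.castSucc 1 ∘ Fin.castSucc)
        (fun Y => pfaffianSpinor M (liftSet b Y)) X + c i / 2 *
      cliff (M (Fin.last n) ∘ Fin.castSucc) (Pi.single (Fin.last n) 1 ∘ Fin.castSucc)
        (fun Y => pfaffianSpinor M (liftSet b Y)) X := by
    simp only [cliff, Finset.mul_sum, ← Finset.sum_add_distrib]
    refine Finset.sum_congr rfl fun j _ => ?_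
    simp only [Function.comp, hM, explodeMatrix_castSucc_castSucc, explodeMatrix_last_castSucc,
      Pi.single_apply, Matrix.one_apply, Fin.castSucc_inj, Fin.castSucc_ne_last, @eq_comm _ i j,
      if_false]
    split_ifs <;> ring
  have hstd : cliff (A i) ((1 : Matrix (Fin n) (Fin n) ℝ) i) (standardSpinor A c) X =
      (if b then √(1 / 2) else 1) * cliff (A i) ((1 : Matrix (Fin n) (Fin n) ℝ) i)
        (fun Y => pfaffianSpinor M (liftSet b Y)) X := by
    simp only [cliff, Finset.mul_sum]
    refine Finset.sum_congr rfl fun j _ => ?_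
    have hpar : Even (symmDiff X {j}).card ↔ ¬ Even X.card := by
      simp [even_card_symmDiff]
    simp only [standardSpinor, evenLift, hpar, hb]
    by_cases hX : Even X.card <;> simp [hX, hM] <;> ring_nf
  have h1 := hz i.castSucc
  have h2 := hz (Fin.last n)
  rw [cliff_liftSet] at h1 h2
  rw [hstd, hrow]
  simp only [standardSpinor, evenLift, paritySign_eq, ← hM, ← hb]
  -- For even `X` the last entry of row `i` contributes `c i`; for odd `X` the unit entry of the
  -- last row contributes `-c i / 2`. The weight `√(1/2)` on odd sets turns these into `√(1/2) * c
  -- i` times the parity.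
  by_cases hX : Even X.card
  · simp only [hb, hX, decide_true, if_true, hM, explodeMatrix_castSucc_last,
      explodeMatrix_last_last, Bool.not_true, hX.neg_one_pow] at h1 h2 ⊢
    linear_combination (-√(1 / 2)) * h1 - √(1 / 2) * c i / 2 * h2
  · simp only [hb, hX, decide_false, if_false, hM, Bool.not_false, Bool.false_eq_true,
      (Nat.not_even_iff_odd.1 hX).neg_one_pow, Pi.single_eq_same,
      Pi.single_eq_of_ne (Fin.castSucc_ne_last i).symm] at h1 h2 ⊢
    linear_combination h1 + c i / 2 * h2 + c i * pfaffianSpinor (explodeMatrix A c) (liftSet true X) * hκ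

/-! ### Signs -/

@[simp] lemma mem_unstarred {n : ℕ} {X : Finset (J n)} {i : Fin n} :
    i ∈ unstarred X ↔ Sum.inl i ∈ X := by
  simp [unstarred]

lemma mem_labelSet {n : ℕ} {T : Finset (Fin n)} {a : J n} :
    a ∈ labelSet T ↔ ∃ i, (if i ∈ T then Sum.inl i else Sum.inr i) = a := by
  simp [labelSet]

@[simp] lemma unstarred_labelSet {n : ℕ} (T : Finset (Fin n)) : unstarred (labelSet T) = T := by
  ext i
  rw [mem_unstarred, mem_labelSet]
  constructor
  · rintro ⟨j, hj⟩
    split_ifs at hj with h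
    · exact Sum.inl_injective hj ▸ h
  · exact fun h => ⟨i, if_pos h⟩

lemma unstarred_explodeSet {n : ℕ} (X : Finset (J n)) :
    unstarred (explodeSet X) = evenLift (unstarred X) := by
  rw [evenLift, eq_liftSet_iff]
  constructor
  · by_cases h : Even (unstarred X).card <;> simp [explodeSet, h, Fin.castSucc_ne_last]
  · intro j
    by_cases h : Even (unstarred X).card <;>
      simp [explodeSet, h, Fin.castSucc_ne_last]

lemma unstarred_symmDiff {n : ℕ} (X Y : Finset (J n)) :
    unstarred (symmDiff X Y) = symmDiff (unstarred X) (unstarred Y) := by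
  ext i; simp [Finset.mem_symmDiff]

lemma evenLift_symmDiff {n : ℕ} (X Y : Finset (Fin n)) :
    symmDiff (evenLift X) (evenLift Y) = evenLift (symmDiff X Y) := by
  rw [evenLift, evenLift, evenLift, eq_liftSet_iff]
  constructor
  · simp only [Finset.mem_symmDiff, last_mem_liftSet, Bool.not_eq_true', decide_eq_false_iff_not,
      even_card_symmDiff]
    tauto
  · simp [Finset.mem_symmDiff]

/-- The weights in `standardSpinor` are positive and do not affect signs. -/
lemma signOf_eq {n : ℕ} (R : Labelled n) (X : Finset (J n)) :
    R.signOf X = SignType.sign (standardSpinor R.left R.last (symmDiff (unstarred X) R.T)) := by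
  have hpos : (0 : ℝ) < if Even (symmDiff (unstarred X) R.T).card then 1 else √(1 / 2) := by
    split_ifs
    · exact one_pos
    · exact Real.sqrt_pos.2 (by norm_num)
  rw [standardSpinor, sign_mul, sign_pos hpos, one_mul, Labelled.signOf, orthogonalSign,
    unstarred_symmDiff, unstarred_explodeSet, unstarred_explodeSet, unstarred_labelSet,
    evenLift_symmDiff, pfaffianSpinor]

/-- The spinors of two standard forms which are connected by moves are proportional. -/
lemma exists_standardSpinor_eq_mul {n : ℕ} {R R' : Labelled n} (hR : R.right = 1)
    (hR' : R'.right = 1) (h : IsIsotropic R.left R.right R.last)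
    (hm : Relation.ReflTransGen Move R R') : ∃ r : ℝ, r ≠ 0 ∧ ∀ X,
      standardSpinor R'.left R'.last (symmDiff X R'.T) =
        r * standardSpinor R.left R.last (symmDiff X R.T) := by
  have h1 : IsLabelledSpinor R fun X => standardSpinor R.left R.last (symmDiff X R.T) := by
    simpa [IsLabelledSpinor] using isSpinor_standardSpinor hR h
  have h2 := isSpinor_standardSpinor hR' (h.reach hm)
  have h3 := h2.proportional hR' (h1.reach hm) (standardSpinor_empty _ _)
  set r := standardSpinor R.left R.last (symmDiff (symmDiff ∅ R'.T) R.T)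
  have h4 : ∀ X, standardSpinor R.left R.last (symmDiff X R.T) =
      r * standardSpinor R'.left R'.last (symmDiff X R'.T) := fun X => by
    simpa using h3 (symmDiff X R'.T)
  have hr : r ≠ 0 := by
    intro hr
    have := h4 R.T
    simp [hr, standardSpinor_empty] at this
  exact ⟨r⁻¹, inv_ne_zero hr, fun X => by rw [h4, inv_mul_cancel_left₀ hr]⟩

/-! ### Standard forms exist -/

lemma IsBasis.eq_labelSet {n : ℕ} {A B : Matrix (Fin n) (Fin n) ℝ} {X : Finset (J n)}
    (h : IsBasis A B X) : labelSet (unstarred X) = X := by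
  obtain ⟨hadm, e, -⟩ := h
  have hcard : X.card = n := by
    have := Fintype.card_congr e
    simpa using this.symm
  symm
  refine Finset.eq_of_subset_of_card_le (fun a ha => ?_) ?_
  · rw [mem_labelSet]
    rcases a with i | i
    · exact ⟨i, if_pos (mem_unstarred.2 ha)⟩
    · exact ⟨i, if_neg fun h => hadm _ ha (mem_unstarred.1 h)⟩
  · rw [hcard]
    exact Finset.card_image_le.trans (by simp)

/-- Swaps lead to any prescribed set of labels. -/
lemma exists_reach_T {n : ℕ} (A B : Matrix (Fin n) (Fin n) ℝ) (c : Fin n → ℝ)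
    (T : Finset (Fin n)) : ∃ R : Labelled n, Relation.ReflTransGen Move ⟨A, B, c, ∅⟩ R ∧ R.T = T ∧
      ∃ ε : Fin n → ℝ, (∀ j, ε j ≠ 0) ∧ ∀ k j,
        R.right k j = ε j * columns A B k (if j ∈ T then Sum.inl j else Sum.inr j) ∧
        R.left k j = ε j * columns A B k (if j ∈ T then Sum.inr j else Sum.inl j) := by
  induction T using Finset.induction_on with
  | empty => exact ⟨_, .refl, rfl, fun _ => 1, by simp, by simp [columns]⟩
  | insert i T hi ih =>
    obtain ⟨R, hm, rfl, ε, hε, h⟩ := ih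
    refine ⟨R.swap i, hm.tail (.swap R i), symmDiff_singleton_of_notMem hi,
      -- The factors collect the sign changes of the swaps; only their non-vanishing is used later.
      fun j => swapFactor i j * ε j, fun j => mul_ne_zero ?_ (hε j), fun k j => ?_⟩
    · unfold swapFactor; split_ifs <;> norm_num
    · by_cases hj : j = i
      · subst hj
        simp [Labelled.swap, h, hi, mul_assoc]
      · simp [Labelled.swap, h, hj, mul_assoc]

lemma exists_standard_form {n : ℕ} {A B : Matrix (Fin n) (Fin n) ℝ} (c : Fin n → ℝ)
    {D : Finset (J n)} (hD : IsBasis A B D) : ∃ R : Labelled n,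
      Relation.ReflTransGen Move ⟨A, B, c, ∅⟩ R ∧ R.right = 1 ∧ R.T = unstarred D := by
  obtain ⟨R, hm, hT, ε, hε, h⟩ := exists_reach_T A B c (unstarred D)
  have hlabel := hD.eq_labelSet
  obtain ⟨-, e, he⟩ := hD
  set f : Fin n → J n := fun j => if j ∈ unstarred D then Sum.inl j else Sum.inr j with hf
  have hright : R.right = (columns A B).submatrix id f * Matrix.diagonal ε := by
    ext k j
    rw [Matrix.mul_diagonal, (h k j).1, mul_comm]
    rfl
  -- Forgetting stars turns the arbitrary enumeration `e` into a permutation of `[n]`, which changes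
  -- the minor only by a sign.
  let g : Fin n → Fin n := fun j => Sum.elim id id (e j : J n)
  have hfg : ∀ j, f (g j) = e j := by
    intro j
    have hj : (e j : J n) ∈ labelSet (unstarred D) := hlabel.symm ▸ (e j).2
    obtain ⟨i, hi⟩ := mem_labelSet.1 hj
    have : g j = i := by
      simp only [g, ← hi]
      split_ifs <;> rfl
    rw [this]
    exact hi
  have hg : Function.Injective g := fun a b hab => e.injective (Subtype.ext (by
    rw [← hfg, ← hfg, hab]))
  let σ : Equiv.Perm (Fin n) := Equiv.ofBijective g (Finite.injective_iff_bijective.1 hg)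
  have hdet : ((columns A B).submatrix id f).det ≠ 0 := by
    intro h0
    apply he
    have : ((columns A B).submatrix id fun j => (e j : J n)) =
        ((columns A B).submatrix id f).submatrix id σ := by
      ext k j
      simp only [Matrix.submatrix_apply, id]
      rw [← hfg]
      rfl
    rw [this, Matrix.det_permute', h0, mul_zero]
  have hunit : IsUnit R.right.det := by
    rw [hright, Matrix.det_mul, Matrix.det_diagonal, isUnit_iff_ne_zero]
    exact mul_ne_zero hdet (Finset.prod_ne_zero_iff.2 fun j _ => hε j)
  exact ⟨R.row R.right⁻¹, hm.tail (.row R _ (Matrix.isUnit_nonsing_inv_det _ hunit)),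
    Matrix.nonsing_inv_mul _ hunit, hT⟩

lemma reach_symm {n : ℕ} {R R' : Labelled n} (h : Relation.ReflTransGen Move R R') :
    Relation.ReflTransGen Move R' R :=
  h.rec .refl fun _ hm ih => .head hm.symm ih

end LagrangianB

theorem mainTheorem3 (n : ℕ) (A B : Matrix (Fin n) (Fin n) ℝ) (c : Fin n → ℝ)
    (hiso : LagrangianB.IsIsotropic A B c) :
    (∀ D : Finset (LagrangianB.J n), LagrangianB.IsBasis A B D →
      ∃ p : {X : Finset (LagrangianB.J n) // LagrangianB.IsBasis A B X} → SignType,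
        LagrangianB.Produces A B c D p) ∧
    (∀ (D : Finset (LagrangianB.J n))
      (p : {X : Finset (LagrangianB.J n) // LagrangianB.IsBasis A B X} → SignType),
      LagrangianB.Produces A B c D p → ∀ X, p X = 1 ∨ p X = -1) ∧
    (∀ (D D' : Finset (LagrangianB.J n))
      (p p' : {X : Finset (LagrangianB.J n) // LagrangianB.IsBasis A B X} → SignType),
      LagrangianB.Produces A B c D p → LagrangianB.Produces A B c D' p' →
      p' = p ∨ p' = -p) := by
  open LagrangianB in
  refine ⟨fun D hD => ?_, ?_, ?_⟩
  · obtain ⟨R, hm, hR, hT⟩ := exists_standard_form c hD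
    exact ⟨fun X => R.signOf X.1, R, hm, hR, by rw [hT, hD.eq_labelSet], fun _ => rfl⟩
  · rintro D p ⟨R, hm, hR, -, hp⟩ X
    -- The spinor of the standard form with labels `X` has value `1` at `X`, so the sign of `X` is
    -- that of the ratio `r`.
    obtain ⟨R', hm', hR', hT'⟩ := exists_standard_form c X.2
    obtain ⟨r, hr, h⟩ := exists_standardSpinor_eq_mul hR' hR (hiso.reach (R := ⟨A, B, c, ∅⟩) hm')
      ((reach_symm hm').trans hm)
    rw [hp, signOf_eq, h, hT', symmDiff_self, Finset.bot_eq_empty, standardSpinor_empty, mul_one]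
    rcases hr.lt_or_gt with hr | hr
    · exact Or.inr (sign_neg hr)
    · exact Or.inl (sign_pos hr)
  · rintro D D' p p' ⟨R, hm, hR, -, hp⟩ ⟨R', hm', hR', -, hp'⟩
    -- The two standard forms are joined through the initial matrix.
    obtain ⟨r, hr, h⟩ := exists_standardSpinor_eq_mul hR hR' (hiso.reach (R := ⟨A, B, c, ∅⟩) hm)
      ((reach_symm hm).trans hm')
    have key : ∀ X, p' X = SignType.sign r * p X := fun X => by
      rw [hp, hp', signOf_eq, signOf_eq, h, sign_mul]
    rcases hr.lt_or_gt with hr | hr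
    · exact Or.inr (funext fun X => by simp [key, sign_neg hr])
    · exact Or.inl (funext fun X => by simp [key, sign_pos hr])
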